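/- Let $N\ge 1$ be an integer, let $0<\lambda\le\Lambda$, and let $\mathrm{Sym}_N$ be the space of real symmetric $N\times N$ matrices. The Pucci extremal operators are $$\mathcal M^+_{\lambda,\Lambda}(M)=\sup_{\lambda I\le A\le\Lambda I}-\mathrm{Tr}(AM),\qquad \mathcal M^-_{\lambda,\Lambda}(M)=\inf_{\lambda I\le A\le\Lambda I}-\mathrm{Tr}(AM),\qquad M\in\mathrm{Sym}_N .$$ Let $F:\mathbb R^N\times\mathrm{Sym}_N\to\mathbb R$ be continuous, with $F(x,0)=0$ for all $x$, and uniformly elliptic, that is, $$\mathcal M^-_{\lambda,\Lambda}(M-Q)\le F(x,M)-F(x,Q)\le \mathcal M^+_{\lambda,\Lambda}(M-Q)\qquad\text{for all } x\in\mathbb R^N,\ M,Q\in\mathrm{Sym}_N,\ Q\ge 0 .$$ Put $\beta=\frac{\Lambda}{\lambda}(N-1)+1$ and assume $\beta>2$ (which holds whenever $N\ge 3$). If $$q>\frac{\beta}{\beta-2}\qquad\text{and}\qquad 1<\gamma\le\frac{\beta}{\beta-1},$$ then every nonnegative viscosity supersolution $u:\mathbb R^N\to[0,\infty)$ of $$F(x,D^2u)\ge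 u^q+|Du|^\gamma\quad\text{in }\mathbb R^N$$ is constant. Here a viscosity supersolution is a lower semicontinuous function $u$ such that, whenever $\varphi$ is $C^2$ near a point $x_0$ and $u-\varphi$ has a local minimum at $x_0$, one has $F(x_0,D^2\varphi(x_0))\ge u(x_0)^q+|D\varphi(x_0)|^\gamma$. -/

import Mathlib

noncomputable section

/-- The space `ℝ^N` with its Euclidean norm. -/
abbrev Euc (N : ℕ) : Type := EuclideanSpace ℝ (Fin N)

/-- `Sym_N`: the space of real symmetric `N × N` matrices. -/
def SymMat (N : ℕ) : Submodule ℝ (Matrix (Fin N) (Fin N) ℝ) where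
  carrier := {M | M.IsSymm}
  add_mem' := fun hA hB => Matrix.IsSymm.add hA hB
  zero_mem' := Matrix.isSymm_zero
  smul_mem' := fun c _ hA => Matrix.IsSymm.smul hA c

/-- The symmetric matrices `A` with `lam I ≤ A ≤ Lam I`. -/
def ellipticMatrices (N : ℕ) (lam Lam : ℝ) : Set (Matrix (Fin N) (Fin N) ℝ) :=
  {A | (A - lam • (1 : Matrix (Fin N) (Fin N) ℝ)).PosSemidef ∧
       (Lam • (1 : Matrix (Fin N) (Fin N) ℝ) - A).PosSemidef}

/-- The Pucci maximal operator `M⁺(M) = sup { -Tr(A M) : lam I ≤ A ≤ Lam I }`. -/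
def pucciMax {N : ℕ} (lam Lam : ℝ) (M : SymMat N) : ℝ :=
  sSup ((fun A => -(A * M.1).trace) '' ellipticMatrices N lam Lam)

/-- The Pucci minimal operator `M⁻(M) = inf { -Tr(A M) : lam I ≤ A ≤ Lam I }`. -/
def pucciMin {N : ℕ} (lam Lam : ℝ) (M : SymMat N) : ℝ :=
  sInf ((fun A => -(A * M.1).trace) '' ellipticMatrices N lam Lam)

theorem ellipticMatrices_nonempty (N : ℕ) {lam Lam : ℝ} (h : lam ≤ Lam) :
    (ellipticMatrices N lam Lam).Nonempty := by
  refine ⟨lam • 1, ?_, ?_⟩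
  · rw [sub_self]
    exact Matrix.PosSemidef.zero
  · rw [← sub_smul]
    exact Matrix.PosSemidef.one.smul (sub_nonneg.2 h)

theorem abs_entry_le_of_mem {N : ℕ} {lam Lam : ℝ} (hl : 0 ≤ lam)
    {A : Matrix (Fin N) (Fin N) ℝ} (hA : A ∈ ellipticMatrices N lam Lam) (i j : Fin N) :
    |A i j| ≤ Lam := by
  have hP : A.PosSemidef := by
    have := hA.1.add (Matrix.PosSemidef.one.smul hl)
    simpa using this
  have hd : ∀ k, A k k ≤ Lam := fun k => by
    have := hA.2.diag_nonneg (i := k)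
    simpa using this
  have hs : A j i = A i j := by simpa using hP.1.apply i j
  have key : ∀ s : ℝ, 0 ≤ A i i + s * A i j + s * A j i + s * s * A j j := fun s => by
    have := hP.dotProduct_mulVec_nonneg (Pi.single i 1 + s • Pi.single j 1)
    simp [Matrix.mulVec_add, Matrix.mulVec_smul, add_dotProduct, dotProduct_add] at this
    linarith
  have h1 := key 1
  have h2 := key (-1)
  have hi := hd i
  have hj := hd j
  rw [abs_le]
  constructor <;> linarith

theorem abs_trace_le_of_mem {N : ℕ} {lam Lam : ℝ} (hl : 0 ≤ lam) (M : SymMat N)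
    {A : Matrix (Fin N) (Fin N) ℝ} (hA : A ∈ ellipticMatrices N lam Lam) :
    |(A * M.1).trace| ≤ ∑ i, ∑ j, Lam * |M.1 j i| := by
  simp only [Matrix.trace, Matrix.diag, Matrix.mul_apply]
  refine (Finset.abs_sum_le_sum_abs _ _).trans (Finset.sum_le_sum fun i _ => ?_)
  refine (Finset.abs_sum_le_sum_abs _ _).trans (Finset.sum_le_sum fun j _ => ?_)
  rw [abs_mul]
  exact mul_le_mul_of_nonneg_right (abs_entry_le_of_mem hl hA i j) (abs_nonneg _)

/-- For `0 ≤ lam ≤ Lam` the supremum in the definition of `pucciMax` is a genuine one. -/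
theorem pucciMax_isLUB {N : ℕ} {lam Lam : ℝ} (hl : 0 ≤ lam) (h : lam ≤ Lam) (M : SymMat N) :
    IsLUB ((fun A => -(A * M.1).trace) '' ellipticMatrices N lam Lam) (pucciMax lam Lam M) := by
  refine isLUB_csSup ((ellipticMatrices_nonempty N h).image _)
    ⟨∑ i, ∑ j, Lam * |M.1 j i|, ?_⟩
  rintro _ ⟨A, hA, rfl⟩
  exact (neg_le_abs _).trans (abs_trace_le_of_mem hl M hA)

/-- For `0 ≤ lam ≤ Lam` the infimum in the definition of `pucciMin` is a genuine one. -/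
theorem pucciMin_isGLB {N : ℕ} {lam Lam : ℝ} (hl : 0 ≤ lam) (h : lam ≤ Lam) (M : SymMat N) :
    IsGLB ((fun A => -(A * M.1).trace) '' ellipticMatrices N lam Lam) (pucciMin lam Lam M) := by
  refine isGLB_csInf ((ellipticMatrices_nonempty N h).image _)
    ⟨-∑ i, ∑ j, Lam * |M.1 j i|, ?_⟩
  rintro _ ⟨A, hA, rfl⟩
  exact neg_le_neg ((le_abs_self _).trans (abs_trace_le_of_mem hl M hA))

/-- Uniform ellipticity of `F : ℝ^N × Sym_N → ℝ` with constants `0 < lam ≤ Lam`. -/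
structure IsUniformlyElliptic {N : ℕ} (lam Lam : ℝ) (F : Euc N → SymMat N → ℝ) : Prop where
  lam_pos : 0 < lam
  lam_le : lam ≤ Lam
  lower : ∀ (x : Euc N) (M Q : SymMat N), Q.1.PosSemidef →
    pucciMin lam Lam (M - Q) ≤ F x M - F x Q
  upper : ∀ (x : Euc N) (M Q : SymMat N), Q.1.PosSemidef →
    F x M - F x Q ≤ pucciMax lam Lam (M - Q)

/-- The matrix of second partial derivatives of `φ` at `x`. -/
def hessianMatrix {N : ℕ} (φ : Euc N → ℝ) (x : Euc N) : Matrix (Fin N) (Fin N) ℝ :=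
  Matrix.of fun i j =>
    fderiv ℝ (fderiv ℝ φ) x (EuclideanSpace.single i 1) (EuclideanSpace.single j 1)

/-- The Hessian `D²φ(x) ∈ Sym_N` of a function `φ` that is `C²` in a neighbourhood of `x`. -/
def hessian {N : ℕ} (φ : Euc N → ℝ) (x : Euc N) (hφ : ContDiffAt ℝ 2 φ x) : SymMat N :=
  ⟨hessianMatrix φ x, by
    have hs : IsSymmSndFDerivAt ℝ φ x := hφ.isSymmSndFDerivAt (by simp)
    exact Matrix.IsSymm.ext fun i j => hs.eq _ _⟩

/-- `u` is a viscosity supersolution of `F(x, D²u) ≥ H(x, u, Du)` in `ℝ^N`: it is lower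
semicontinuous, and whenever a `C²` function `φ` is such that `u - φ` has a local minimum at `x`,
one has `F(x, D²φ(x)) ≥ H(x, u(x), Dφ(x))`. -/
structure IsViscositySupersolution {N : ℕ} (F : Euc N → SymMat N → ℝ)
    (H : Euc N → ℝ → Euc N → ℝ) (u : Euc N → ℝ) : Prop where
  lsc : LowerSemicontinuous u
  test : ∀ (x : Euc N) (φ : Euc N → ℝ) (hφ : ContDiffAt ℝ 2 φ x),
    IsLocalMin (fun y => u y - φ y) x →
      H x (u x) (gradient φ x) ≤ F x (hessian φ x hφ)

/-- The effective dimension `β = (Lam / lam) (N - 1) + 1` of the Pucci maximal operator. -/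
def effectiveDim (N : ℕ) (lam Lam : ℝ) : ℝ := Lam / lam * ((N : ℝ) - 1) + 1

end

/-! Since `u ^ q ≥ 0` and `F x 0 = 0`, ellipticity gives `M⁺(D²u) ≥ |Du|^γ` in the viscosity sense,
and this alone forces `u` to be constant. If `u y < u x₀`, compare `u` with a radial function about
`x₀` whose slope at distance `r` is the fundamental one `r^(1-β)` times the logarithmic factor `(C -
2k log r)^(-p)`, `p = 1/(γ-1)`. For small `k` it is a strict subsolution
(`radialSlope_strict_subsolution`), the condition `γ ≤ β/(β-1)` making this hold at all larger
radii. As `γ < 2`, `p > 1`: the function falls to `-∞` at a finite radius, yet for `C` large is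
almost flat up to `y` (`exists_radial_profile`). So `u` minus it has an interior minimum on an
annulus, a contradiction. -/

/-! ### Pucci operator on rank-one perturbations of the identity -/

-- Factor `B = Cᵀ * C` and apply Cauchy–Schwarz to each row of `C`.
open scoped Matrix MatrixOrder in
theorem Matrix.PosSemidef.dotProduct_mulVec_le_trace_mul {n : Type*} [Fintype n] [DecidableEq n]
    {B : Matrix n n ℝ} (hB : B.PosSemidef) (x : n → ℝ) :
    x ⬝ᵥ (B *ᵥ x) ≤ B.trace * (x ⬝ᵥ x) := by
  obtain ⟨C, rfl⟩ : ∃ C : Matrix n n ℝ, B = Cᵀ * C := by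
    obtain ⟨C, hC⟩ := CStarAlgebra.nonneg_iff_eq_star_mul_self.1 hB.nonneg
    exact ⟨C, by simpa [Matrix.star_eq_conjTranspose] using hC⟩
  have h1 : x ⬝ᵥ ((Cᵀ * C) *ᵥ x) = ∑ i, (∑ j, C i j * x j) ^ 2 := by
    rw [← Matrix.mulVec_mulVec, Matrix.dotProduct_mulVec, Matrix.vecMul_transpose]
    simp [dotProduct, Matrix.mulVec, sq]
  have h2 : (Cᵀ * C).trace * (x ⬝ᵥ x) = ∑ i, (∑ j, C i j ^ 2) * ∑ j, x j ^ 2 := by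
    rw [← Finset.sum_mul, Finset.sum_comm]
    simp [Matrix.trace, Matrix.mul_apply, dotProduct, sq]
  rw [h1, h2]
  exact Finset.sum_le_sum fun i _ => Finset.sum_mul_sq_le_sq_mul_sq _ _ _

/-- A bound for `pucciMax` on matrices of the form `-(v I + b x xᵀ)`. -/
theorem pucciMax_le_of_rankOne {N : ℕ} {lam Lam : ℝ} (hl : 0 ≤ lam) (h : lam ≤ Lam) (M : SymMat N)
    (x : Euc N) (hx : x ≠ 0) {v b K : ℝ} (hv : 0 ≤ v)
    (hM : ∀ i j, M.1 i j = -(v * (if i = j then 1 else 0) + b * (x i * x j)))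
    (hK : ∀ a ∈ Set.Icc lam Lam, a * (v + b * ‖x‖ ^ 2) + Lam * ((N : ℝ) - 1) * v ≤ K) :
    pucciMax lam Lam M ≤ K := by
  refine (pucciMax_isLUB hl h M).2 ?_
  rintro _ ⟨A, ⟨hA1, hA2⟩, rfl⟩
  have hs : 0 < ‖x‖ ^ 2 := by positivity
  have hxx : x.ofLp ⬝ᵥ x.ofLp = ‖x‖ ^ 2 := by
    rw [EuclideanSpace.real_norm_sq_eq]
    simp [dotProduct, sq]
  set q := x.ofLp ⬝ᵥ (A.mulVec x.ofLp) with hq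
  have h1 : 0 ≤ q - lam * ‖x‖ ^ 2 := by
    have := hA1.dotProduct_mulVec_nonneg x.ofLp
    simpa [Matrix.sub_mulVec, dotProduct_sub, Matrix.smul_mulVec, hxx] using this
  have h2 : 0 ≤ Lam * ‖x‖ ^ 2 - q := by
    have := hA2.dotProduct_mulVec_nonneg x.ofLp
    simpa [Matrix.sub_mulVec, dotProduct_sub, Matrix.smul_mulVec, hxx] using this
  -- Applied to `Lam • 1 - A`, this bounds `A.trace` by the Rayleigh quotient of `x` plus `Lam` for
  -- each of the other `N - 1` directions.
  have h3 : Lam * ‖x‖ ^ 2 - q ≤ (Lam * N - A.trace) * ‖x‖ ^ 2 := by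
    have := hA2.dotProduct_mulVec_le_trace_mul x.ofLp
    simpa [Matrix.sub_mulVec, dotProduct_sub, Matrix.smul_mulVec, hxx, Matrix.trace_sub] using this
  have htr : -(A * M.1).trace = v * A.trace + b * q := by
    have : ∀ i j, A i j * M.1 j i = -(v * (A i j * (if j = i then 1 else 0)) +
        b * (x i * (A i j * x j))) := by
      intro i j; rw [hM]; ring
    simp only [Matrix.trace, Matrix.diag, Matrix.mul_apply, this, hq, dotProduct, Matrix.mulVec,
      Finset.mul_sum, Finset.sum_neg_distrib, neg_neg, Finset.sum_add_distrib]
    simp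
  have ha := hK (q / ‖x‖ ^ 2) ⟨by rw [le_div_iff₀ hs]; linarith, by rw [div_le_iff₀ hs]; linarith⟩
  have hqa : q = q / ‖x‖ ^ 2 * ‖x‖ ^ 2 := by field_simp
  set a := q / ‖x‖ ^ 2
  have h4 : A.trace ≤ a + Lam * (N - 1) := by
    rw [hqa, ← sub_mul] at h3
    have := le_of_mul_le_mul_right h3 hs
    linarith
  change -(A * M.1).trace ≤ K
  rw [htr, hqa]
  nlinarith [mul_le_mul_of_nonneg_left h4 hv]

/-! ### Derivatives of radial functions -/

section Radial

variable {N : ℕ} {x₀ x : Euc N} {ψ v : ℝ → ℝ} {v' : ℝ}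

theorem hasFDerivAt_radial (hψ : HasDerivAt ψ (-(v (‖x - x₀‖ ^ 2) / 2)) (‖x - x₀‖ ^ 2)) :
    HasFDerivAt (fun y => ψ (‖y - x₀‖ ^ 2)) (-(v (‖x - x₀‖ ^ 2)) • innerSL ℝ (x - x₀)) x := by
  have h := hψ.comp_hasFDerivAt x ((hasFDerivAt_id x).sub_const x₀).norm_sq
  refine h.congr_fderiv ?_
  ext y
  simp
  ring

theorem gradient_radial (hψ : HasDerivAt ψ (-(v (‖x - x₀‖ ^ 2) / 2)) (‖x - x₀‖ ^ 2)) :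
    gradient (fun y => ψ (‖y - x₀‖ ^ 2)) x = -(v (‖x - x₀‖ ^ 2)) • (x - x₀) := by
  refine HasGradientAt.gradient ?_
  rw [hasGradientAt_iff_hasFDerivAt]
  refine (hasFDerivAt_radial hψ).congr_fderiv ?_
  ext y
  simp

theorem hessianMatrix_radial
    (hψ : ∀ᶠ s in nhds (‖x - x₀‖ ^ 2), HasDerivAt ψ (-(v s / 2)) s)
    (hv : HasDerivAt v v' (‖x - x₀‖ ^ 2)) (i j : Fin N) :
    hessianMatrix (fun y => ψ (‖y - x₀‖ ^ 2)) x i j =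
      -(v (‖x - x₀‖ ^ 2) * (if i = j then 1 else 0) +
        2 * v' * ((x - x₀) i * (x - x₀) j)) := by
  have hc : Filter.Tendsto (fun y : Euc N => ‖y - x₀‖ ^ 2) (nhds x) (nhds (‖x - x₀‖ ^ 2)) :=
    Continuous.tendsto (by fun_prop) x
  have h1 : fderiv ℝ (fun y => ψ (‖y - x₀‖ ^ 2)) =ᶠ[nhds x]
      fun y => -(v (‖y - x₀‖ ^ 2)) • innerSL ℝ (y - x₀) := by
    filter_upwards [hc.eventually hψ] with y hy
    exact (hasFDerivAt_radial hy).fderiv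
  have h2 := hv.comp_hasFDerivAt x ((hasFDerivAt_id x).sub_const x₀).norm_sq
  have h3 : HasFDerivAt (fun y : Euc N => innerSL ℝ (y - x₀)) (innerSL ℝ) x :=
    (innerSL ℝ).hasFDerivAt.comp x ((hasFDerivAt_id x).sub_const x₀)
  have h4 := h2.neg.smul h3
  have h5 := (h4.congr_of_eventuallyEq (f₁ := fderiv ℝ (fun y => ψ (‖y - x₀‖ ^ 2))) h1).fderiv
  have h6 : ∀ y z : Euc N, fderiv ℝ (fderiv ℝ (fun y => ψ (‖y - x₀‖ ^ 2))) x y z =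
      -v (‖x - x₀‖ ^ 2) * inner ℝ y z +
        -(v' * (2 * inner ℝ (x - x₀) y)) * inner ℝ (x - x₀) z := by
    intro y z
    rw [h5]
    simp only [inner_sub_left]
    simp
    exact Or.inl rfl
  simp only [hessianMatrix, Matrix.of_apply, h6, EuclideanSpace.inner_single_right]
  rcases eq_or_ne i j with rfl | hij
  · simp
    ring
  · simp [hij, hij.symm]
    ring

end Radial

/-! ### The log-corrected fundamental profile -/

/-- The function `v` such that `-v(|x|²) x` is the gradient of the radial comparison function. -/
noncomputable def radialSlope (β p k C s : ℝ) : ℝ := s ^ (-(β / 2)) * (C - k * Real.log s) ^ (-p)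

section Profile

variable {β p k C s : ℝ}

theorem log_lt_of_lt_exp_div (hk : 0 < k) (hs : s ∈ Set.Ioo 0 (Real.exp (C / k))) :
    0 < C - k * Real.log s := by
  have := (Real.log_lt_iff_lt_exp hs.1).2 hs.2
  rw [lt_div_iff₀ hk] at this
  linarith

theorem radialSlope_pos (hk : 0 < k) (hs : s ∈ Set.Ioo 0 (Real.exp (C / k))) :
    0 < radialSlope β p k C s :=
  mul_pos (Real.rpow_pos_of_pos hs.1 _) (Real.rpow_pos_of_pos (log_lt_of_lt_exp_div hk hs) _)

theorem hasDerivAt_log_rpow (e : ℝ) (hs : 0 < s) (hL : 0 < C - k * Real.log s) :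
    HasDerivAt (fun s => (C - k * Real.log s) ^ e)
      (-(e * k) * (C - k * Real.log s) ^ (e - 1) / s) s := by
  have h := (((Real.hasDerivAt_log hs.ne').const_mul k).const_sub C).rpow_const (p := e)
    (Or.inl hL.ne')
  convert h using 1
  field_simp

theorem hasDerivAt_radialSlope (hs : 0 < s) (hL : 0 < C - k * Real.log s) :
    HasDerivAt (radialSlope β p k C)
      (s ^ (-(β / 2)) * (-(β / 2) * (C - k * Real.log s) ^ (-p) +
        p * k * (C - k * Real.log s) ^ (-p - 1)) / s) s := by
  have h := (Real.hasDerivAt_rpow_const (p := -(β / 2)) (Or.inl hs.ne')).mul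
    (hasDerivAt_log_rpow (-p) hs hL)
  refine h.congr_deriv ?_
  rw [Real.rpow_sub_one hs.ne']
  field_simp

theorem contDiffOn_radialSlope (hk : 0 < k) {n : WithTop ℕ∞} :
    ContDiffOn ℝ n (radialSlope β p k C) (Set.Ioo 0 (Real.exp (C / k))) := by
  intro s hs
  refine ContDiffAt.contDiffWithinAt ?_
  refine (contDiffAt_id.rpow_const_of_ne hs.1.ne').mul (ContDiffAt.rpow_const_of_ne ?_ ?_)
  · exact contDiffAt_const.sub (contDiffAt_const.mul (Real.contDiffAt_log.2 hs.1.ne'))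
  · exact (log_lt_of_lt_exp_div hk hs).ne'

/-- A primitive of the slope: it drops by less than `η` between `s₀` and `s₁`, but becomes
negative further out. -/
theorem exists_radial_profile {s₀ s₁ η h : ℝ} (hβ : 2 < β) (hp : 1 < p) (hk : 0 < k)
    (hs₀ : 0 < s₀) (hs : s₀ < s₁) (hη : 0 < η) :
    ∃ (C s₂ : ℝ) (ψ : ℝ → ℝ), s₁ < s₂ ∧ s₂ < Real.exp (C / k) ∧ ψ s₀ = h ∧ h - η < ψ s₁ ∧
      ψ s₂ < 0 ∧ ContDiffOn ℝ 2 ψ (Set.Ioo 0 (Real.exp (C / k))) ∧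
      ∀ s ∈ Set.Ioo 0 (Real.exp (C / k)), HasDerivAt ψ (-(radialSlope β p k C s / 2)) s := by
  -- The drop is at most the length times a bound for the slope, which tends to 0 as `C → ∞`.
  obtain ⟨C, hC1, hC2⟩ : ∃ C, k * Real.log s₁ < C ∧
      s₀ ^ (-(β / 2)) * (C - k * Real.log s₁) ^ (-p) / 2 * (s₁ - s₀) < η := by
    have ht : Filter.Tendsto (fun C : ℝ => s₀ ^ (-(β / 2)) * (C - k * Real.log s₁) ^ (-p) / 2 *
        (s₁ - s₀)) Filter.atTop (nhds (s₀ ^ (-(β / 2)) * 0 / 2 * (s₁ - s₀))) := by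
      refine (((Filter.Tendsto.const_mul _ ?_).div_const _).mul_const _)
      exact (tendsto_rpow_neg_atTop (by linarith)).comp
        (Filter.tendsto_atTop_add_const_right _ _ Filter.tendsto_id)
    exact ((Filter.eventually_gt_atTop _).and (ht.eventually_lt_const (by simpa using hη))).exists
  set S := Real.exp (C / k) with hS
  have hs₁ : 0 < s₁ := hs₀.trans hs
  have hs₁S : s₁ < S := by
    rw [hS, ← Real.log_lt_iff_lt_exp hs₁, lt_div_iff₀ hk]
    linarith
  set v := radialSlope β p k C with hv
  have hvc : ContinuousOn v (Set.Ioo 0 S) := (contDiffOn_radialSlope hk (n := 0)).continuousOn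
  set ψ : ℝ → ℝ := fun s => h - (∫ t in s₀..s, v t) / 2 with hψ
  have hI₀ : s₀ ∈ Set.Ioo 0 S := ⟨hs₀, hs.trans hs₁S⟩
  have hd : ∀ s ∈ Set.Ioo 0 S, HasDerivAt ψ (-(v s / 2)) s := by
    intro s hsI
    have hI : IntervalIntegrable v MeasureTheory.volume s₀ s := by
      refine (hvc.mono ?_).intervalIntegrable
      exact (Set.ordConnected_Ioo).uIcc_subset hI₀ hsI
    have hm : StronglyMeasurableAtFilter v (nhds s) MeasureTheory.volume :=
      hvc.stronglyMeasurableAtFilter isOpen_Ioo s hsI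
    exact ((intervalIntegral.integral_hasDerivAt_right hI hm
      (hvc.continuousAt (isOpen_Ioo.mem_nhds hsI))).div_const 2).const_sub h
  have hdrop : h - η < ψ s₁ := by
    have hb := intervalIntegral.norm_integral_le_of_norm_le_const (a := s₀) (b := s₁) (f := v)
      (C := s₀ ^ (-(β / 2)) * (C - k * Real.log s₁) ^ (-p)) (by
        intro s hsI
        rw [Set.uIoc_of_le hs.le] at hsI
        have h0 : 0 < s := hs₀.trans hsI.1
        have hI : s ∈ Set.Ioo 0 S := ⟨h0, hsI.2.trans_lt hs₁S⟩
        rw [Real.norm_of_nonneg (radialSlope_pos hk hI).le]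
        have hl := Real.log_le_log h0 hsI.2
        refine mul_le_mul ?_ ?_ (Real.rpow_nonneg (log_lt_of_lt_exp_div hk hI).le _)
          (Real.rpow_nonneg hs₀.le _)
        · exact Real.rpow_le_rpow_of_nonpos hs₀ hsI.1.le (by linarith)
        · exact Real.rpow_le_rpow_of_nonpos (by linarith) (by nlinarith) (by linarith))
    rw [abs_of_pos (sub_pos.2 hs), Real.norm_eq_abs] at hb
    have := le_abs_self (∫ t in s₀..s₁, v t)
    simp only [hψ]
    linarith
  have hSpos : 0 < S := Real.exp_pos _
  -- Since `1 - β / 2 < 0`, `v s / 2 ≥ S ^ (1 - β / 2) / (2 * s) * (C - k * log s) ^ (-p)`. With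
  -- this `c` the right side is the derivative of `c * (C - k * log s) ^ (1 - p)`, so `g` decreases
  -- and `ψ → -∞` at `S`.
  set c := S ^ (1 - β / 2) / (2 * (p - 1) * k) with hc
  have hp1 : 0 < p - 1 := by linarith
  have hcpos : 0 < c := by positivity
  set g : ℝ → ℝ := fun s => ψ s + c * (C - k * Real.log s) ^ (1 - p) with hg
  have hgd : ∀ s ∈ Set.Ioo 0 S, HasDerivAt g (-(v s / 2) +
      c * (-((1 - p) * k) * (C - k * Real.log s) ^ (1 - p - 1) / s)) s := fun s hsI =>
    (hd s hsI).add
      ((hasDerivAt_log_rpow (1 - p) hsI.1 (log_lt_of_lt_exp_div hk hsI)).const_mul c)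
  have hganti : AntitoneOn g (Set.Ioo 0 S) := by
    refine antitoneOn_of_deriv_nonpos (convex_Ioo _ _)
      (fun s hsI => (hgd s hsI).continuousAt.continuousWithinAt) ?_ ?_
    · rw [interior_Ioo]
      exact fun s hsI => (hgd s hsI).differentiableAt.differentiableWithinAt
    · rw [interior_Ioo]
      intro s hsI
      rw [(hgd s hsI).deriv]
      have hL := log_lt_of_lt_exp_div hk hsI
      have e1 : (1 - p - 1 : ℝ) = -p := by ring
      have e2 : c * (-((1 - p) * k) * (C - k * Real.log s) ^ (-p) / s) =
          S ^ (1 - β / 2) / s * (C - k * Real.log s) ^ (-p) / 2 := by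
        rw [hc]
        field_simp
        ring
      have e3 : S ^ (1 - β / 2) / s ≤ s ^ (-(β / 2)) := by
        rw [div_le_iff₀ hsI.1, ← Real.rpow_add_one hsI.1.ne']
        rw [show -(β / 2) + 1 = 1 - β / 2 by ring]
        exact Real.rpow_le_rpow_of_nonpos hsI.1 hsI.2.le (by linarith)
      have e4 := mul_le_mul_of_nonneg_right e3 (Real.rpow_nonneg hL.le (-p))
      rw [e1, e2, hv, radialSlope]
      linarith
  -- `l` is the value of `C - k * log s` at the outer end `s₂`.
  obtain ⟨l, hl1, hl2, hl3⟩ : ∃ l : ℝ, g s₁ / c < l ^ (1 - p) ∧ l < C - k * Real.log s₁ ∧ 0 < l := by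
    have ht : Filter.Tendsto (fun l : ℝ => l ^ (1 - p)) (nhdsWithin 0 (Set.Ioi 0)) Filter.atTop :=
      tendsto_rpow_neg_nhdsGT_zero (by linarith)
    have h2 : ∀ᶠ l in nhdsWithin (0 : ℝ) (Set.Ioi 0), l < C - k * Real.log s₁ :=
      nhdsWithin_le_nhds (Iio_mem_nhds (by linarith))
    exact ((ht.eventually_gt_atTop _).and (h2.and self_mem_nhdsWithin)).exists
  have hL2 : C - k * Real.log (Real.exp ((C - l) / k)) = l := by
    rw [Real.log_exp]
    field_simp
    ring
  have hs12 : s₁ < Real.exp ((C - l) / k) := by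
    rw [← Real.log_lt_iff_lt_exp hs₁, lt_div_iff₀ hk]
    linarith
  have hs2S : Real.exp ((C - l) / k) < S := by
    rw [hS]
    gcongr
    linarith
  refine ⟨C, Real.exp ((C - l) / k), ψ, hs12, hs2S, by simp [hψ], hdrop, ?_, ?_, hd⟩
  · have := hganti ⟨hs₁, hs₁S⟩ ⟨Real.exp_pos _, hs2S⟩ hs12.le
    have h3 : g (Real.exp ((C - l) / k)) = ψ (Real.exp ((C - l) / k)) + c * l ^ (1 - p) := by
      simp only [hg, hL2]
    rw [div_lt_iff₀ hcpos] at hl1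
    linarith
  · rw [show (2 : WithTop ℕ∞) = 1 + 1 by norm_num,
      contDiffOn_succ_iff_deriv_of_isOpen isOpen_Ioo]
    refine ⟨fun s hsI => (hd s hsI).differentiableAt.differentiableWithinAt, by simp, ?_⟩
    exact ((contDiffOn_radialSlope hk).div_const 2).neg.congr fun s hsI => (hd s hsI).deriv

end Profile

/-! ### Strict subsolution property -/

/-- The radial comparison function is a strict subsolution of `M⁺(D²φ) ≥ |Dφ|^γ`. -/
theorem radialSlope_strict_subsolution {N : ℕ} {lam Lam γ p k C s s₀ : ℝ} (hl : 0 < lam)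
    (hβ : 2 < effectiveDim N lam Lam) (hγ1 : 1 < γ)
    (hγ2 : γ ≤ effectiveDim N lam Lam / (effectiveDim N lam Lam - 1)) (hp : p = 1 / (γ - 1))
    (hk : 0 < k)
    (hkp : 2 * p * k * Lam <
      s₀ ^ ((effectiveDim N lam Lam - (effectiveDim N lam Lam - 1) * γ) / 2))
    (hs₀ : 0 < s₀) (hs : s₀ ≤ s) (hL : 0 < C - k * Real.log s) :
    ∃ v' K : ℝ, HasDerivAt (radialSlope (effectiveDim N lam Lam) p k C) v' s ∧
      (∀ a ∈ Set.Icc lam Lam,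
        a * (radialSlope (effectiveDim N lam Lam) p k C s + 2 * v' * s) +
          Lam * ((N : ℝ) - 1) * radialSlope (effectiveDim N lam Lam) p k C s ≤ K) ∧
      K < (radialSlope (effectiveDim N lam Lam) p k C s * Real.sqrt s) ^ γ := by
  have hN : Lam * ((N : ℝ) - 1) = lam * (effectiveDim N lam Lam - 1) := by
    rw [effectiveDim]
    field_simp
    ring
  set β := effectiveDim N lam Lam
  have hspos : 0 < s := hs₀.trans_le hs
  have hp0 : 0 < p := by
    rw [hp]
    exact one_div_pos.2 (by linarith)
  set L := C - k * Real.log s with hLdef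
  set w := s ^ (-(β / 2)) with hw
  have hwpos : 0 < w := Real.rpow_pos_of_pos hspos _
  have hz : 0 < L ^ (-p) := Real.rpow_pos_of_pos hL _
  have hz' : 0 < L ^ (-p - 1) := Real.rpow_pos_of_pos hL _
  have hv : radialSlope β p k C s = w * L ^ (-p) := rfl
  refine ⟨_, w * (2 * p * k * Lam * L ^ (-p - 1)), hasDerivAt_radialSlope hspos hL, ?_, ?_⟩
  · rintro a ⟨ha1, ha2⟩
    rw [hN, hv, ← hLdef, ← hw]
    -- At `a = lam` the pure power terms cancel, which is what fixes the exponent `β`; a larger `a`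
    -- only helps.
    have e : a * (w * L ^ (-p) +
          2 * (w * (-(β / 2) * L ^ (-p) + p * k * L ^ (-p - 1)) / s) * s) +
        lam * (β - 1) * (w * L ^ (-p)) =
        w * (2 * p * k * a * L ^ (-p - 1)) - (a - lam) * ((β - 1) * (w * L ^ (-p))) := by
      field_simp
      ring
    rw [e]
    have h1 : 0 ≤ (a - lam) * ((β - 1) * (w * L ^ (-p))) :=
      mul_nonneg (by linarith) (mul_nonneg (by linarith) (by positivity))
    have h2 : w * (2 * p * k * a * L ^ (-p - 1)) ≤ w * (2 * p * k * Lam * L ^ (-p - 1)) := by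
      gcongr
    linarith
  · have hδ : 0 ≤ (β - (β - 1) * γ) / 2 := by
      rw [le_div_iff₀ (by linarith)] at hγ2
      linarith
    have hpow : 2 * p * k * Lam < s ^ ((β - (β - 1) * γ) / 2) :=
      hkp.trans_le (Real.rpow_le_rpow hs₀.le hs hδ)
    -- The choice of `p` gives `p * γ = p + 1`, so both sides carry the same power of `L` and `C`
    -- stays free.
    have e : (radialSlope β p k C s * Real.sqrt s) ^ γ =
        w * (s ^ ((β - (β - 1) * γ) / 2) * L ^ (-p - 1)) := by
      have hpγ : -p * γ = -p - 1 := by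
        have : γ - 1 ≠ 0 := by linarith
        rw [hp]
        field_simp
        ring
      rw [hv, Real.sqrt_eq_rpow, Real.mul_rpow (by positivity) (by positivity),
        Real.mul_rpow hwpos.le hz.le, ← Real.rpow_mul hL.le, hpγ, hw, ← Real.rpow_mul hspos.le,
        ← Real.rpow_mul hspos.le, mul_right_comm, ← mul_assoc, ← Real.rpow_add hspos,
        ← Real.rpow_add hspos]
      ring_nf
    rw [e]
    gcongr

/-! ### Comparison on an annulus -/

/-- A nonnegative supersolution cannot be touched from below by a radial strict subsolution of
`M⁺(D²φ) ≥ |Dφ|^γ`. -/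
theorem IsViscositySupersolution.not_isLocalMin_radial {N : ℕ} {lam Lam q γ : ℝ}
    {F : Euc N → SymMat N → ℝ} (hFell : IsUniformlyElliptic lam Lam F)
    (hF0 : ∀ x : Euc N, F x 0 = 0) {u : Euc N → ℝ} (hu0 : ∀ x, 0 ≤ u x)
    (hu : IsViscositySupersolution F (fun _ s p => s ^ q + ‖p‖ ^ γ) u)
    {x₀ x : Euc N} (hx : x ≠ x₀) {ψ v : ℝ → ℝ} {v' K : ℝ}
    (hψ : ∀ᶠ s in nhds (‖x - x₀‖ ^ 2), HasDerivAt ψ (-(v s / 2)) s)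
    (hψ2 : ContDiffAt ℝ 2 ψ (‖x - x₀‖ ^ 2)) (hv : HasDerivAt v v' (‖x - x₀‖ ^ 2))
    (hv0 : 0 ≤ v (‖x - x₀‖ ^ 2))
    (hK : ∀ a ∈ Set.Icc lam Lam, a * (v (‖x - x₀‖ ^ 2) + 2 * v' * ‖x - x₀‖ ^ 2) +
      Lam * ((N : ℝ) - 1) * v (‖x - x₀‖ ^ 2) ≤ K)
    (hKγ : K < (v (‖x - x₀‖ ^ 2) * ‖x - x₀‖) ^ γ) :
    ¬ IsLocalMin (fun y => u y - ψ (‖y - x₀‖ ^ 2)) x := by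
  intro hmin
  have hΦ : ContDiffAt ℝ 2 (fun y => ψ (‖y - x₀‖ ^ 2)) x :=
    hψ2.comp x ((contDiffAt_id.sub contDiffAt_const).norm_sq ℝ)
  have h1 := hu.test x _ hΦ hmin
  have h2 := hFell.upper x (hessian _ x hΦ) 0 Matrix.PosSemidef.zero
  rw [hF0, sub_zero, sub_zero] at h2
  have h3 := pucciMax_le_of_rankOne hFell.lam_pos.le hFell.lam_le (hessian _ x hΦ) (x - x₀)
    (sub_ne_zero.2 hx) hv0 (fun i j => hessianMatrix_radial hψ hv i j) hK
  simp only [gradient_radial hψ.self_of_nhds, norm_smul, norm_neg, Real.norm_of_nonneg hv0] at h1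
  have h4 := Real.rpow_nonneg (hu0 x) q
  linarith

/-- A nonnegative supersolution attains its minimum at every point. -/
theorem IsViscositySupersolution.le_apply {N : ℕ} {lam Lam q γ : ℝ}
    {F : Euc N → SymMat N → ℝ} (hFell : IsUniformlyElliptic lam Lam F)
    (hF0 : ∀ x : Euc N, F x 0 = 0) (hβ : 2 < effectiveDim N lam Lam) (hγ1 : 1 < γ)
    (hγ2 : γ ≤ effectiveDim N lam Lam / (effectiveDim N lam Lam - 1))
    {u : Euc N → ℝ} (hu0 : ∀ x, 0 ≤ u x)
    (hu : IsViscositySupersolution F (fun _ s p => s ^ q + ‖p‖ ^ γ) u) (x₀ y : Euc N) :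
    u x₀ ≤ u y := by
  by_contra! hlt
  obtain ⟨h, hyh, hhx⟩ := exists_between hlt
  have hyx : y ≠ x₀ := fun e => by simp [e] at hlt
  obtain ⟨ε, hε, hball⟩ := Metric.eventually_nhds_iff.1 (hu.lsc x₀ h hhx)
  obtain ⟨r, hr0, hr⟩ := exists_between (lt_min hε (norm_pos_iff.2 (sub_ne_zero.2 hyx)))
  obtain ⟨hrε, hry⟩ := lt_min_iff.1 hr
  set β := effectiveDim N lam Lam with hβdef
  have hLam : 0 < Lam := hFell.lam_pos.trans_le hFell.lam_le
  set p := 1 / (γ - 1) with hp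
  -- Equivalent to `γ < 2`, which follows from `β > 2`.
  have hp1 : 1 < p := by
    rw [hp, lt_div_iff₀ (by linarith)]
    rw [le_div_iff₀ (by linarith)] at hγ2
    nlinarith
  have hr2 : 0 < r ^ 2 := by positivity
  -- Half the threshold value, for a strict inequality.
  set k := (r ^ 2) ^ ((β - (β - 1) * γ) / 2) / (4 * p * Lam) with hk
  have hkpos : 0 < k := by positivity
  have hkp : 2 * p * k * Lam < (r ^ 2) ^ ((β - (β - 1) * γ) / 2) := by
    have h1 : 2 * p * k * Lam = (r ^ 2) ^ ((β - (β - 1) * γ) / 2) / 2 := by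
      rw [hk]
      field_simp
      norm_num
    have := Real.rpow_pos_of_pos hr2 ((β - (β - 1) * γ) / 2)
    linarith
  obtain ⟨C, s₂, ψ, hs12, hs2S, hψ0, hψ1, hψ2, hψc, hψd⟩ :=
    exists_radial_profile (h := h) hβ hp1 hkpos hr2 (pow_lt_pow_left₀ hry hr0.le two_ne_zero)
      (sub_pos.2 hyh)
  set S := Real.exp (C / k)
  set A : Set (Euc N) := (fun x => ‖x - x₀‖ ^ 2) ⁻¹' Set.Icc (r ^ 2) s₂ with hA
  have hcont : Continuous fun x : Euc N => ‖x - x₀‖ ^ 2 := by fun_prop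
  have hAS : ∀ x ∈ A, ‖x - x₀‖ ^ 2 ∈ Set.Ioo 0 S := fun x hx =>
    ⟨hr2.trans_le hx.1, hx.2.trans_lt hs2S⟩
  have hAc : IsCompact A := by
    refine (isCompact_closedBall x₀ (Real.sqrt s₂)).of_isClosed_subset
      (isClosed_Icc.preimage hcont) fun x hx => ?_
    rw [mem_closedBall_iff_norm]
    exact Real.le_sqrt_of_sq_le hx.2
  have hyA : y ∈ A := ⟨pow_le_pow_left₀ hr0.le hry.le 2, hs12.le⟩
  have hlsc : LowerSemicontinuousOn (fun x => u x - ψ (‖x - x₀‖ ^ 2)) A := by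
    have hc : ContinuousOn (fun x : Euc N => -ψ (‖x - x₀‖ ^ 2)) A :=
      (hψc.continuousOn.comp hcont.continuousOn hAS).neg
    simpa only [sub_eq_add_neg] using
      (hu.lsc.lowerSemicontinuousOn A).add hc.lowerSemicontinuousOn
  obtain ⟨x, hxA, hxmin⟩ := hlsc.exists_isMinOn ⟨y, hyA⟩ hAc
  -- The drop allowed up to `y` is `h - u y`, so `ψ` still exceeds `u` there. The difference is
  -- positive on both boundary spheres: `u > h = ψ` on the inner one, `ψ < 0 ≤ u` on the outer.
  have hneg : u x - ψ (‖x - x₀‖ ^ 2) < 0 := (hxmin hyA).trans_lt (by simp only; linarith)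
  have hx1 : r ^ 2 < ‖x - x₀‖ ^ 2 := by
    refine lt_of_le_of_ne hxA.1 fun e => ?_
    have hxr : ‖x - x₀‖ = r := by
      rwa [eq_comm, sq_eq_sq₀ (norm_nonneg _) hr0.le] at e
    have := hball (y := x) (by rwa [dist_eq_norm, hxr])
    rw [← e, hψ0] at hneg
    linarith
  have hx2 : ‖x - x₀‖ ^ 2 < s₂ := by
    refine lt_of_le_of_ne hxA.2 fun e => ?_
    rw [e] at hneg
    linarith [hu0 x]
  have hloc : IsLocalMin (fun x => u x - ψ (‖x - x₀‖ ^ 2)) x :=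
    hxmin.isLocalMin (hcont.continuousAt.preimage_mem_nhds (Icc_mem_nhds hx1 hx2))
  have hxS := hAS x hxA
  obtain ⟨v', K, hv', hK, hKγ⟩ := radialSlope_strict_subsolution hFell.lam_pos hβ hγ1
    hγ2 hp hkpos hkp hr2 hx1.le (log_lt_of_lt_exp_div hkpos hxS)
  rw [Real.sqrt_sq (norm_nonneg _)] at hKγ
  refine hu.not_isLocalMin_radial hFell hF0 hu0 ?_ ?_ (hψc.contDiffAt (isOpen_Ioo.mem_nhds hxS))
    hv' (radialSlope_pos hkpos hxS).le hK hKγ hloc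
  · rintro rfl
    simp at hxS
  · filter_upwards [isOpen_Ioo.mem_nhds hxS] with s hs using hψd s hs

theorem mainTheorem1 (N : ℕ) (lam Lam q γ : ℝ) (F : Euc N → SymMat N → ℝ)
    (hFcont : Continuous (fun p : Euc N × SymMat N => F p.1 p.2))
    (hFell : IsUniformlyElliptic lam Lam F)
    (hF0 : ∀ x : Euc N, F x 0 = 0)
    (hβ : 2 < effectiveDim N lam Lam)
    (hq : effectiveDim N lam Lam / (effectiveDim N lam Lam - 2) < q)
    (hγ1 : 1 < γ)
    (hγ2 : γ ≤ effectiveDim N lam Lam / (effectiveDim N lam Lam - 1))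
    (u : Euc N → ℝ) (hu0 : ∀ x, 0 ≤ u x)
    (hu : IsViscositySupersolution F (fun _ s p => s ^ q + ‖p‖ ^ γ) u) :
    ∃ c : ℝ, ∀ x, u x = c :=
  ⟨u 0, fun x => le_antisymm (hu.le_apply hFell hF0 hβ hγ1 hγ2 hu0 x 0)
    (hu.le_apply hFell hF0 hβ hγ1 hγ2 hu0 0 x)⟩
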